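/- **Setting.** Fix $d$ and real polynomials $q_1(n,k)$, $q_2(n,k)$. Let $\mathscr K:[-1,1]^d\times[-1,1]^d\to\mathbb R$ be a kernel. Let $\overline X,\overline Y\subset[-1,1]^d$ be tensor grids of Chebyshev nodes of the first kind, with any positive number of nodes in each direction ($m$ nodes in one direction are $\cos\frac{(2k-1)\pi}{2m}$, $k=1,\dots,m$, with weights $\frac{\pi}{m}\sin\frac{(2k-1)\pi}{2m}$; weights on the tensor grid are products). Let $S_k$, $T_l$ be the tensor Lagrange basis functions of the two grids, and suppose that $$\Big|\mathscr K(x,y)-\sum_{k,l}S_k(x)\,\mathscr K(\bar x_k,\bar y_l)\,T_l(y)\Big|\le\delta\qquad\text{for all }x,y\in[-1,1]^d .$$ Put $K_w=\mathrm{diag}(\overline W_X)^{1/2}\,\mathscr K(\overline X,\overline Y)\,\mathrm{diag}(\overline W_Y)^{1/2}$ and $r_0=\max(|\overline X|,|\overline Y|)$. Singular values $\sigma_1\ge\sigma_2\ge\cdots$ are continued by $0$. **Strong RRQR.** A strong rank-revealing QR factorization of rank $k$ of a matrix $A$ with $n$ columns is a factorization $A\Pi=QR$, with $\Pi$ a permutation,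 $Q$ orthogonal, $R=\begin{bmatrix}R_{11}&R_{12}\\0&R_{22}\end{bmatrix}$ upper triangular and $R_{11}\in\mathbb R^{k\times k}$ invertible, such that, with $A_1$ the first $k$ columns of $A\Pi$ (the pivot columns), $T=R_{11}^{-1}R_{12}$ and $E=A\Pi-A_1[\,I\;\;T\,]$, $$\sigma_i(A_1)\,q_1(n,k)\ge\sigma_i(A)\ (1\le i\le k),\qquad \sigma_j(E)\le q_1(n,k)\,\sigma_{k+j}(A)\ (j\ge1),\qquad \|T\|_F\le q_2(n,k).$$ **Pivots.** Let $\widehat Y\subset\overline Y$, $|\widehat Y|=r_1$, be the pivot columns of a strong RRQR of $K_w$ with error $E_y$, and let $\widehat X\subset\overline X$, $|\widehat X|=r_1$, be selected in one of the following two ways. 1. $\widehat X$ consists of the pivots of a strong RRQR of rank $r_1$ of $K_w(\overline X,\widehat Y)^\top$ (two successive factorizations). Put $\varepsilon=\|E_y\|_2$. 2. $\widehat X$ consists of the pivots of a strong RRQR of rank $r_1$ of $K_w^\top$ with error $E_x$, and the core $\widehat K_w=K_w(\widehat X,\widehat Y)$ inherits the lower bound $\sigma_i(\widehat K_w)\,q_1(r_0,r_1)\ge\sigma_i(K_w)$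 for $1\le i\le r_1$. Put $\varepsilon=\max(\|E_x\|_2,\|E_y\|_2)$. Assume $\delta\le\varepsilon$. **Theorem.** There are polynomials $r(r_0,r_1)$, $r'(r_0,r_1)$ and a constant $C$, depending only on $d$, $q_1$, $q_2$ (not on $\mathscr K$, the grids, $r_1$, $\delta$, $\varepsilon$ or the pivots), such that in every such situation $\mathscr K(\widehat X,\widehat Y)$ is invertible and for all $x,y\in[-1,1]^d$ $$\big|\mathscr K(x,y)-\mathscr K(x,\widehat Y)\,\mathscr K(\widehat X,\widehat Y)^{-1}\,\mathscr K(\widehat X,y)\big|\le C\,\varepsilon\,r(r_0,r_1),$$ $$\big|\mathscr K(x,y)-\mathscr K(x,\widehat Y)\,\mathscr K(\widehat X,\widehat Y)^{-1}\,\mathscr K(\widehat X,y)\big|\le C\,\sigma_{r_1+1}(K_w)\,r'(r_0,r_1).$$ -/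

import Mathlib

open scoped Matrix Matrix.Norms.L2Operator

noncomputable section

namespace SkelInterp

/-! ### Chebyshev tensor grids, weights and interpolation on `[-1,1]^d` -/

/-- The `m` Chebyshev nodes of the first kind, `cos ((2k-1)π/(2m))` for `k = 1, …, m`
(here the index `k : Fin m` is zero-based). -/
def chebNode (m : ℕ) (k : Fin m) : ℝ :=
  Real.cos ((2 * (k : ℝ) + 1) / (2 * (m : ℝ)) * Real.pi)

/-- The associated integration weights `(π/m) sin ((2k-1)π/(2m))` for the measure `dx`. -/
def chebWeight (m : ℕ) (k : Fin m) : ℝ :=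
  Real.pi / (m : ℝ) * Real.sin ((2 * (k : ℝ) + 1) / (2 * (m : ℝ)) * Real.pi)

/-- Indices of the tensor grid with `m i` nodes in direction `i`. -/
abbrev GridIdx {d : ℕ} (m : Fin d → ℕ) : Type := (i : Fin d) → Fin (m i)

/-- The number of points of the tensor grid. -/
def gridCard {d : ℕ} (m : Fin d → ℕ) : ℕ := Fintype.card (GridIdx m)

/-- The points of the tensor grid. -/
def gridNode {d : ℕ} (m : Fin d → ℕ) (k : GridIdx m) : Fin d → ℝ :=
  fun i => chebNode (m i) (k i)

/-- The weights of the tensor grid: products of the one-dimensional weights. -/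
def gridWeight {d : ℕ} (m : Fin d → ℕ) (k : GridIdx m) : ℝ :=
  ∏ i, chebWeight (m i) (k i)

/-- The tensor Lagrange basis function of the grid point `k`, evaluated at `x`. -/
def gridLagrange {d : ℕ} (m : Fin d → ℕ) (k : GridIdx m) (x : Fin d → ℝ) : ℝ :=
  ∏ i, (Lagrange.basis Finset.univ (chebNode (m i)) (k i)).eval (x i)

/-- The cube `[-1,1]^d`. -/
def cube (d : ℕ) : Set (Fin d → ℝ) := {x | ∀ i, x i ∈ Set.Icc (-1 : ℝ) 1}

/-- Interpolation of the kernel at the two grids approximates it within `δ`, uniformly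
on `[-1,1]^d × [-1,1]^d`. -/
def InterpolatesWithin {d : ℕ} (K : (Fin d → ℝ) → (Fin d → ℝ) → ℝ)
    (mX mY : Fin d → ℕ) (δ : ℝ) : Prop :=
  ∀ x ∈ cube d, ∀ y ∈ cube d,
    |K x y - ∑ k : GridIdx mX, ∑ l : GridIdx mY,
      gridLagrange mX k x * K (gridNode mX k) (gridNode mY l) * gridLagrange mY l y| ≤ δ

/-- The kernel matrix `K(X, Y)` of two finite sequences of points. -/
def kernelMatrix {d : ℕ} (K : (Fin d → ℝ) → (Fin d → ℝ) → ℝ) {α β : Type*}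
    (X : α → Fin d → ℝ) (Y : β → Fin d → ℝ) : Matrix α β ℝ :=
  Matrix.of fun a b => K (X a) (Y b)

/-- The weighted node matrix `K_w = diag(W_X)^{1/2} K(X̄, Ȳ) diag(W_Y)^{1/2}`. -/
def nodeMatrix {d : ℕ} (K : (Fin d → ℝ) → (Fin d → ℝ) → ℝ) (mX mY : Fin d → ℕ) :
    Matrix (GridIdx mX) (GridIdx mY) ℝ :=
  Matrix.diagonal (fun k => Real.sqrt (gridWeight mX k)) *
    kernelMatrix K (gridNode mX) (gridNode mY) *
    Matrix.diagonal (fun l => Real.sqrt (gridWeight mY l))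

/-! ### Strong rank-revealing QR factorizations -/

/-- The `i`-th singular value of a matrix, in decreasing order and zero-based:
`singVal A 0` is the largest one, and `singVal A i = 0` for `i ≥ rank A`. -/
def singVal {μ ν : Type*} [Fintype μ] [Fintype ν] [DecidableEq ν]
    (A : Matrix μ ν ℝ) (i : ℕ) : ℝ :=
  (Matrix.toEuclideanLin A).singularValues i

/-- The Frobenius norm. -/
def frobNorm {μ ν : Type*} [Fintype μ] [Fintype ν] (A : Matrix μ ν ℝ) : ℝ :=
  Real.sqrt (∑ i, ∑ j, A i j ^ 2)

/-- The value `q(a, b)` of a real polynomial in two variables at natural numbers. -/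
def polyVal (q : MvPolynomial (Fin 2) ℝ) (a b : ℕ) : ℝ :=
  MvPolynomial.eval ![(a : ℝ), (b : ℝ)] q

/-- A column-pivoted QR factorization `A Π = Q R`, with `Q` orthogonal and `R` upper triangular
(trapezoidal), split after the first `k` rows and columns of `R`; the leading block `R₁₁`
is invertible. -/
structure PivotedQR {μ ν : Type*} [Fintype μ] [Fintype ν]
    (A : Matrix μ ν ℝ) (k : ℕ) where
  /-- the column permutation `Π` -/
  perm : Fin (Fintype.card ν) ≃ ν
  /-- the orthogonal factor -/
  Q : Matrix μ (Fin (Fintype.card μ)) ℝ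
  /-- the triangular factor -/
  R : Matrix (Fin (Fintype.card μ)) (Fin (Fintype.card ν)) ℝ
  orthogonal : Qᵀ * Q = 1
  triangular : ∀ (i : Fin (Fintype.card μ)) (j : Fin (Fintype.card ν)), (j : ℕ) < (i : ℕ) → R i j = 0
  factor : A.submatrix id perm = Q * R
  le_rows : k ≤ Fintype.card μ
  le_cols : k ≤ Fintype.card ν
  leading_isUnit : IsUnit (R.submatrix (Fin.castLE le_rows) (Fin.castLE le_cols)).det

namespace PivotedQR

variable {μ ν : Type*} [Fintype μ] [Fintype ν] {A : Matrix μ ν ℝ} {k : ℕ}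

/-- The leading `k × k` block `R₁₁`. -/
def R₁₁ (F : PivotedQR A k) : Matrix (Fin k) (Fin k) ℝ :=
  F.R.submatrix (Fin.castLE F.le_rows) (Fin.castLE F.le_cols)

/-- The position of the `j`-th column after the first `k` ones. -/
def tailIdx (F : PivotedQR A k) (j : Fin (Fintype.card ν - k)) : Fin (Fintype.card ν) :=
  ⟨k + (j : ℕ), by have h₁ := j.isLt; have h₂ := F.le_cols; omega⟩

/-- The upper right block `R₁₂`. -/
def R₁₂ (F : PivotedQR A k) : Matrix (Fin k) (Fin (Fintype.card ν - k)) ℝ :=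
  F.R.submatrix (Fin.castLE F.le_rows) F.tailIdx

/-- The pivots: the `k` columns of `A` that `Π` moves to the front. -/
def pivot (F : PivotedQR A k) (j : Fin k) : ν := F.perm (Fin.castLE F.le_cols j)

/-- The matrix `A₁` of the `k` pivot columns of `A`. -/
def A₁ (F : PivotedQR A k) : Matrix μ (Fin k) ℝ := A.submatrix id F.pivot

/-- The interpolation operator `T = R₁₁⁻¹ R₁₂`. -/
def T (F : PivotedQR A k) : Matrix (Fin k) (Fin (Fintype.card ν - k)) ℝ := F.R₁₁⁻¹ * F.R₁₂

/-- The matrix `[I  T]`. -/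
def IT (F : PivotedQR A k) : Matrix (Fin k) (Fin (Fintype.card ν)) ℝ :=
  Matrix.of fun i j =>
    if h : (j : ℕ) < k then (1 : Matrix (Fin k) (Fin k) ℝ) i ⟨j, h⟩
    else F.T i ⟨(j : ℕ) - k, by have := j.isLt; omega⟩

/-- The approximation error `E` in `A Π = A₁ [I  T] + E`. -/
def E (F : PivotedQR A k) : Matrix μ (Fin (Fintype.card ν)) ℝ :=
  A.submatrix id F.perm - F.A₁ * F.IT

/-- The factorization is a *strong* rank-revealing one, with bounds `q₁(n, k)` and `q₂(n, k)`
where `n` is the number of columns of `A`: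
`σ_i(A₁) ≥ σ_i(A) / q₁`, `σ_j(E) ≤ σ_{k+j}(A) q₁` and `‖T‖_F ≤ q₂`. -/
structure IsStrong [DecidableEq ν] (q₁ q₂ : MvPolynomial (Fin 2) ℝ) (F : PivotedQR A k) :
    Prop where
  lower : ∀ i < k, singVal A i ≤ polyVal q₁ (Fintype.card ν) k * singVal F.A₁ i
  upper : ∀ j, singVal F.E j ≤ singVal A (k + j) * polyVal q₁ (Fintype.card ν) k
  interp : frobNorm F.T ≤ polyVal q₂ (Fintype.card ν) k

end PivotedQR

/-- `k` pivot rows `I` and `k` pivot columns `J` of `A` selected through strong rank-revealing QR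
factorizations (a CUR decomposition), with error `ε` in the spectral norm.

The columns always come from a strong RRQR of `A`. The rows come
* either (`successive`) from a strong RRQR of `A(:, J)ᵀ`, the transpose of the column skeleton;
* or (`simultaneous`) from a strong RRQR of `Aᵀ`, the core `A(I, J)` inheriting the lower bound
  on the singular values. (Two independent factorizations of `A` and `Aᵀ` do not give this by
  themselves: for `A = 1` and `k = 1` the core may be zero.) -/
inductive IsStrongCUR (q₁ q₂ : MvPolynomial (Fin 2) ℝ) {μ ν : Type*} [Fintype μ] [Fintype ν]
    [DecidableEq μ] [DecidableEq ν] (A : Matrix μ ν ℝ) {k : ℕ}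
    (I : Fin k → μ) (J : Fin k → ν) (ε : ℝ) : Prop
  | successive (F : PivotedQR A k) (G : PivotedQR (A.submatrix id J)ᵀ k)
      (hF : F.IsStrong q₁ q₂) (hG : G.IsStrong q₁ q₂)
      (hJ : F.pivot = J) (hI : G.pivot = I)
      (hε : ε = ‖F.E‖) : IsStrongCUR q₁ q₂ A I J ε
  | simultaneous (F : PivotedQR A k) (G : PivotedQR Aᵀ k)
      (hF : F.IsStrong q₁ q₂) (hG : G.IsStrong q₁ q₂)
      (hJ : F.pivot = J) (hI : G.pivot = I)
      (hcore : ∀ i < k, singVal A i ≤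
        polyVal q₁ (max (Fintype.card μ) (Fintype.card ν)) k * singVal (A.submatrix I J) i)
      (hε : ε = max ‖F.E‖ ‖G.E‖) : IsStrongCUR q₁ q₂ A I J ε

/-! ### The skeletonized interpolant -/

/-- `K(x, Ŷ) K(X̂, Ŷ)⁻¹ K(X̂, y)`. -/
def skelApprox {d k : ℕ} (K : (Fin d → ℝ) → (Fin d → ℝ) → ℝ)
    (Xhat Yhat : Fin k → Fin d → ℝ) (x y : Fin d → ℝ) : ℝ :=
  (fun j => K x (Yhat j)) ⬝ᵥ ((kernelMatrix K Xhat Yhat)⁻¹ *ᵥ fun i => K (Xhat i) y)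

end SkelInterp

end


/-!
The skeletonized interpolant is unchanged when rows and columns are rescaled, so it may be computed
from the weighted matrix `K_w`, and the kernel is, up to `δ`, the bilinear form `s(x)ᵀ K_w t(y)` of
Lagrange bases scaled by the weights. A strong RRQR writes all columns of `K_w` as bounded
combinations of the pivot columns, and likewise for the rows of the pivot columns, up to errors of
norm at most `ε ≤ q₁ σ_{r₁+1}(K_w)`. The core keeps its singular values up to polynomial factors,
so `ε ‖K̂_w⁻¹‖` is polynomially bounded: the inverse of the core may be large, but it only ever
meets errors of size `ε` on one side or the other, or on both with a factor `ε` to spare.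

On the Chebyshev side, with `T_m` the Chebyshev polynomial vanishing at the nodes `cos θ_k`, the
identity `|T_m'(cos θ_k)| sin θ_k = m` and Markov's bound `|T_m'| ≤ m²` show both that the Lagrange
basis is bounded by `m` and that the weights are at least `m⁻²`.
-/


namespace SkelInterp

section SingularValues

open LinearMap Module

variable {𝕜 E F : Type*} [RCLike 𝕜]
  [NormedAddCommGroup E] [InnerProductSpace 𝕜 E] [FiniteDimensional 𝕜 E]
  [NormedAddCommGroup F] [InnerProductSpace 𝕜 F] [FiniteDimensional 𝕜 F]

/-- An orthonormal basis of right singular vectors of `T`, in the order of the singular values. -/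
noncomputable def rightSingularBasis (T : E →ₗ[𝕜] F) :
    OrthonormalBasis (Fin (finrank 𝕜 E)) 𝕜 E :=
  T.isSymmetric_adjoint_comp_self.eigenvectorBasis rfl

theorem adjoint_apply_rightSingularBasis (T : E →ₗ[𝕜] F) (i : Fin (finrank 𝕜 E)) :
    adjoint T (T (rightSingularBasis T i)) =
      ((T.singularValues i : 𝕜) ^ 2) • rightSingularBasis T i := by
  have h := T.isSymmetric_adjoint_comp_self.apply_eigenvectorBasis rfl i
  rw [← T.sq_singularValues_fin rfl i] at h
  exact_mod_cast h

theorem norm_apply_sq_eq_sum_singularValues (T : E →ₗ[𝕜] F) (x : E) :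
    ‖T x‖ ^ 2 = ∑ i : Fin (finrank 𝕜 E),
      T.singularValues i ^ 2 * ‖inner 𝕜 (rightSingularBasis T i) x‖ ^ 2 := by
  apply RCLike.ofReal_injective (K := 𝕜)
  push_cast
  rw [← inner_self_eq_norm_sq_to_K (𝕜 := 𝕜), ← adjoint_inner_right,
    ← (rightSingularBasis T).sum_inner_mul_inner]
  refine Finset.sum_congr rfl fun i _ => ?_
  rw [adjoint_inner_right, ← adjoint_inner_left, adjoint_apply_rightSingularBasis,
    inner_smul_left, ← RCLike.conj_mul, inner_conj_symm]
  simp only [map_pow, RCLike.conj_ofReal]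
  ring

theorem norm_apply_le_singularValues_mul (T : E →ₗ[𝕜] F) {k : ℕ} {x : E}
    (hx : ∀ i : Fin (finrank 𝕜 E), (i : ℕ) < k → inner 𝕜 (rightSingularBasis T i) x = 0) :
    ‖T x‖ ≤ T.singularValues k * ‖x‖ := by
  have hk := T.singularValues_nonneg
  refine le_of_sq_le_sq ?_ (mul_nonneg (hk k) (norm_nonneg x))
  rw [mul_pow, norm_apply_sq_eq_sum_singularValues,
    ← (rightSingularBasis T).sum_sq_norm_inner_right, Finset.mul_sum]
  refine Finset.sum_le_sum fun i _ => ?_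
  rcases lt_or_ge (i : ℕ) k with h | h
  · simp [hx i h]
  · gcongr
    exacts [hk i, T.singularValues_antitone h]

theorem singularValues_mul_le_norm_apply (T : E →ₗ[𝕜] F) {k : ℕ} {x : E}
    (hx : ∀ i : Fin (finrank 𝕜 E), k < (i : ℕ) → inner 𝕜 (rightSingularBasis T i) x = 0) :
    T.singularValues k * ‖x‖ ≤ ‖T x‖ := by
  have hk := T.singularValues_nonneg
  refine le_of_sq_le_sq ?_ (norm_nonneg _)
  rw [mul_pow, norm_apply_sq_eq_sum_singularValues,
    ← (rightSingularBasis T).sum_sq_norm_inner_right, Finset.mul_sum]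
  refine Finset.sum_le_sum fun i _ => ?_
  rcases lt_or_ge k (i : ℕ) with h | h
  · simp [hx i h]
  · gcongr
    exacts [hk k, T.singularValues_antitone h]

theorem singularValues_le_of_forall_mem (T : E →ₗ[𝕜] F) {k : ℕ} {c : ℝ} (hc : 0 ≤ c)
    (V : Submodule 𝕜 E) (hV : finrank 𝕜 E ≤ finrank 𝕜 V + k)
    (h : ∀ x ∈ V, ‖T x‖ ≤ c * ‖x‖) : T.singularValues k ≤ c := by
  rcases le_or_gt (finrank 𝕜 E) k with hk | hk
  · rwa [T.singularValues_of_finrank_le hk]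
  let v : Fin (k + 1) → E := rightSingularBasis T ∘ Fin.castLE hk
  obtain ⟨x, ⟨hxV, hxv⟩, hx0⟩ : ∃ x ∈ V ⊓ Submodule.span 𝕜 (Set.range v), x ≠ 0 := by
    refine Submodule.exists_mem_ne_zero_of_ne_bot fun h => ?_
    have h₁ := Submodule.finrank_add_finrank_le_of_disjoint (disjoint_iff.2 h)
    have h₂ : finrank 𝕜 (Submodule.span 𝕜 (Set.range v)) = k + 1 := by
      simpa using finrank_span_eq_card
        ((rightSingularBasis T).orthonormal.linearIndependent.comp _ (Fin.castLE_injective hk))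
    omega
  refine le_of_mul_le_mul_right ?_ (norm_pos_iff.2 hx0)
  refine (singularValues_mul_le_norm_apply T fun i hi => ?_).trans (h x hxV)
  suffices Submodule.span 𝕜 (Set.range v) ≤
      (Submodule.span 𝕜 {rightSingularBasis T i})ᗮ from
    Submodule.mem_orthogonal_singleton_iff_inner_right.1 (this hxv)
  rw [Submodule.span_le]
  rintro _ ⟨j, rfl⟩
  refine Submodule.mem_orthogonal_singleton_iff_inner_right.2
    ((rightSingularBasis T).orthonormal.2 ?_)
  rintro rfl
  exact absurd hi (by simp only [Fin.val_castLE, not_lt]; omega)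

theorem singularValues_adjoint_le (T : E →ₗ[𝕜] F) (k : ℕ) :
    (adjoint T).singularValues k ≤ T.singularValues k := by
  let v : {i : Fin (finrank 𝕜 E) // (i : ℕ) < k} → F := fun i => T (rightSingularBasis T i)
  refine singularValues_le_of_forall_mem _ (T.singularValues_nonneg k)
    (Submodule.span 𝕜 (Set.range v))ᗮ ?_ fun y hy => ?_
  · have h₁ := (Submodule.span 𝕜 (Set.range v)).finrank_add_finrank_orthogonal
    have h₂ : finrank 𝕜 (Submodule.span 𝕜 (Set.range v)) ≤ k := by
      refine (finrank_range_le_card v).trans ?_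
      simpa using Fintype.card_le_of_injective
        (fun i : {i : Fin (finrank 𝕜 E) // (i : ℕ) < k} => (⟨i, i.2⟩ : Fin k))
        fun i j hij => Subtype.ext (Fin.ext (by simpa using hij))
    omega
  · have hz : ‖T (adjoint T y)‖ ≤ T.singularValues k * ‖adjoint T y‖ := by
      refine norm_apply_le_singularValues_mul T fun i hi => ?_
      rw [adjoint_inner_right]
      exact hy _ (Submodule.subset_span ⟨⟨i, hi⟩, rfl⟩)
    rcases (norm_nonneg (adjoint T y)).eq_or_lt with h | h
    · rw [← h]
      exact mul_nonneg (T.singularValues_nonneg k) (norm_nonneg y)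
    · refine le_of_mul_le_mul_right ?_ h
      calc ‖adjoint T y‖ * ‖adjoint T y‖ = RCLike.re (inner 𝕜 (T (adjoint T y)) y) := by
            rw [← adjoint_inner_right, inner_self_eq_norm_mul_norm]
        _ ≤ ‖T (adjoint T y)‖ * ‖y‖ := re_inner_le_norm _ _
        _ ≤ T.singularValues k * ‖adjoint T y‖ * ‖y‖ := by gcongr
        _ = T.singularValues k * ‖y‖ * ‖adjoint T y‖ := by ring

theorem singularValues_adjoint (T : E →ₗ[𝕜] F) (k : ℕ) :
    (adjoint T).singularValues k = T.singularValues k :=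
  le_antisymm (singularValues_adjoint_le T k) <| by
    simpa using singularValues_adjoint_le (adjoint T) k

end SingularValues
section OperatorNorm

open WithLp (toLp)

variable {μ ν ξ : Type*} [Fintype μ] [Fintype ν] [Fintype ξ]

theorem l2_opNorm_le_of_forall_mulVec [DecidableEq ν] (A : Matrix μ ν ℝ) {c : ℝ} (hc : 0 ≤ c)
    (h : ∀ v, ‖toLp 2 (A *ᵥ v)‖ ≤ c * ‖toLp 2 v‖) : ‖A‖ ≤ c := by
  rw [Matrix.l2_opNorm_def]
  exact ContinuousLinearMap.opNorm_le_bound _ hc fun v => h v.ofLp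

theorem l2_opNorm_transpose [DecidableEq μ] [DecidableEq ν] (A : Matrix μ ν ℝ) :
    ‖Aᵀ‖ = ‖A‖ := by
  rw [← Matrix.conjTranspose_eq_transpose_of_trivial, Matrix.l2_opNorm_conjTranspose]

theorem norm_toLp_comp_le {f : μ → ν} (hf : Function.Injective f) (v : ν → ℝ) :
    ‖toLp 2 (v ∘ f)‖ ≤ ‖toLp 2 v‖ := by
  simp only [EuclideanSpace.norm_eq]
  gcongr
  exact (Finset.sum_map Finset.univ ⟨f, hf⟩ fun j => ‖v j‖ ^ 2).symm.trans_le
    (Finset.sum_le_univ_sum_of_nonneg fun j => sq_nonneg _)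

theorem l2_opNorm_submatrix_id_le [DecidableEq ν] (A : Matrix μ ν ℝ) {f : ξ → μ}
    (hf : Function.Injective f) : ‖A.submatrix f id‖ ≤ ‖A‖ :=
  l2_opNorm_le_of_forall_mulVec _ (norm_nonneg A) fun v =>
    (norm_toLp_comp_le hf (A *ᵥ v)).trans (Matrix.l2_opNorm_mulVec A (toLp 2 v))

theorem l2_opNorm_id_submatrix_le [DecidableEq ν] [DecidableEq ξ] (A : Matrix μ ν ℝ) {f : ξ → ν}
    (hf : Function.Injective f) : ‖A.submatrix id f‖ ≤ ‖A‖ := by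
  classical
  rw [← l2_opNorm_transpose, Matrix.transpose_submatrix, ← l2_opNorm_transpose A]
  exact l2_opNorm_submatrix_id_le Aᵀ hf

theorem l2_opNorm_one_submatrix_le [DecidableEq ν] {f : μ → ν} (hf : Function.Injective f) :
    ‖(1 : Matrix ν ν ℝ).submatrix f id‖ ≤ 1 :=
  (l2_opNorm_submatrix_id_le 1 hf).trans <|
    l2_opNorm_le_of_forall_mulVec _ zero_le_one fun v => by simp

theorem l2_opNorm_le_frobNorm [DecidableEq ν] (A : Matrix μ ν ℝ) : ‖A‖ ≤ frobNorm A := by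
  refine l2_opNorm_le_of_forall_mulVec A (Real.sqrt_nonneg _) fun v => ?_
  rw [EuclideanSpace.norm_eq, EuclideanSpace.norm_eq, frobNorm, ← Real.sqrt_mul (by positivity),
    Finset.sum_mul]
  simp only [Real.norm_eq_abs, sq_abs]
  gcongr with i
  exact Finset.sum_mul_sq_le_sq_mul_sq _ _ _

theorem norm_toLp_le_card_mul {v : ν → ℝ} {c : ℝ} (hc : 0 ≤ c) (hv : ∀ j, |v j| ≤ c) :
    ‖toLp 2 v‖ ≤ Fintype.card ν * c := by
  rw [EuclideanSpace.norm_eq]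
  refine Real.sqrt_le_iff.2 ⟨by positivity, ?_⟩
  calc ∑ j, ‖v j‖ ^ 2 ≤ ∑ _j : ν, c ^ 2 := by gcongr with j; exact hv j
    _ = Fintype.card ν * c ^ 2 := by simp
    _ ≤ (Fintype.card ν : ℝ) ^ 2 * c ^ 2 := by gcongr; exact_mod_cast Nat.le_self_pow two_ne_zero _
    _ = (Fintype.card ν * c) ^ 2 := by ring

theorem abs_dotProduct_le (u v : ν → ℝ) : |u ⬝ᵥ v| ≤ ‖toLp 2 u‖ * ‖toLp 2 v‖ := by
  simpa [EuclideanSpace.inner_toLp_toLp, dotProduct_comm] using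
    abs_real_inner_le_norm (toLp 2 u) (toLp 2 v)

theorem abs_dotProduct_mulVec_le [DecidableEq ν] (u : μ → ℝ) (A : Matrix μ ν ℝ) (v : ν → ℝ) :
    |u ⬝ᵥ A *ᵥ v| ≤ ‖toLp 2 u‖ * ‖A‖ * ‖toLp 2 v‖ := by
  rw [mul_assoc]
  exact (abs_dotProduct_le u _).trans <|
    mul_le_mul_of_nonneg_left (Matrix.l2_opNorm_mulVec A (toLp 2 v)) (norm_nonneg _)

end OperatorNorm

section SingVal

open WithLp (toLp)

variable {μ ν : Type*} [Fintype μ] [Fintype ν] [DecidableEq ν]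

theorem singVal_nonneg (A : Matrix μ ν ℝ) (i : ℕ) : 0 ≤ singVal A i :=
  LinearMap.singularValues_nonneg _ i

theorem singVal_antitone (A : Matrix μ ν ℝ) : Antitone (singVal A) :=
  LinearMap.singularValues_antitone _

theorem singVal_transpose [DecidableEq μ] (A : Matrix μ ν ℝ) (i : ℕ) :
    singVal Aᵀ i = singVal A i := by
  rw [singVal, ← Matrix.conjTranspose_eq_transpose_of_trivial,
    Matrix.toEuclideanLin_conjTranspose_eq_adjoint, singularValues_adjoint, singVal]

theorem l2_opNorm_le_singVal_zero (A : Matrix μ ν ℝ) : ‖A‖ ≤ singVal A 0 :=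
  l2_opNorm_le_of_forall_mulVec A (singVal_nonneg A 0) fun v =>
    norm_apply_le_singularValues_mul (Matrix.toEuclideanLin A) (x := toLp 2 v)
      fun _ hi => absurd hi (Nat.not_lt_zero _)

theorem singVal_pos_iff_lt_rank (A : Matrix μ ν ℝ) (i : ℕ) : 0 < singVal A i ↔ i < A.rank := by
  rw [singVal, LinearMap.singularValues_pos_iff_lt_finrank_range,
    Matrix.rank_eq_finrank_range_toLin A (EuclideanSpace.basisFun μ ℝ).toBasis
      (EuclideanSpace.basisFun ν ℝ).toBasis, Matrix.toEuclideanLin_eq_toLin_orthonormal]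

theorem isUnit_det_of_singVal_pos (A : Matrix ν ν ℝ)
    (h : ∀ i < Fintype.card ν, 0 < singVal A i) : IsUnit A.det := by
  have hrank : Fintype.card ν ≤ A.rank :=
    le_of_forall_lt fun i hi => (singVal_pos_iff_lt_rank A i).1 (h i hi)
  rwa [← Matrix.isUnit_iff_isUnit_det, ← Matrix.linearIndependent_cols_iff_isUnit,
    linearIndependent_iff_card_le_finrank_span, Set.finrank, ← Matrix.rank_eq_finrank_span_cols]

theorem singVal_mul_norm_le (A : Matrix μ ν ℝ) {i : ℕ} (hi : Fintype.card ν ≤ i + 1)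
    (v : ν → ℝ) : singVal A i * ‖toLp 2 v‖ ≤ ‖toLp 2 (A *ᵥ v)‖ := by
  refine singularValues_mul_le_norm_apply (Matrix.toEuclideanLin A) fun j hj => ?_
  have hj' := j.isLt.trans_eq finrank_euclideanSpace
  omega

theorem singVal_mul_l2_opNorm_inv_le (A : Matrix ν ν ℝ) (hA : IsUnit A.det) {i : ℕ}
    (hi : Fintype.card ν ≤ i + 1) : singVal A i * ‖A⁻¹‖ ≤ 1 := by
  rcases (singVal_nonneg A i).eq_or_lt with h0 | h0
  · simp [← h0]
  rw [← le_div_iff₀' h0]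
  refine l2_opNorm_le_of_forall_mulVec _ (by positivity) fun v => ?_
  rw [div_mul_eq_mul_div, one_mul, le_div_iff₀' h0]
  simpa [Matrix.mulVec_mulVec, Matrix.mul_nonsing_inv A hA] using
    singVal_mul_norm_le A hi (A⁻¹ *ᵥ v)

end SingVal

namespace PivotedQR

variable {μ ν : Type*} [Fintype μ] [Fintype ν] {A : Matrix μ ν ℝ} {k : ℕ}

theorem pivot_injective (F : PivotedQR A k) : Function.Injective F.pivot :=
  F.perm.injective.comp (Fin.castLE_injective F.le_cols)

theorem R₁₁_eq (F : PivotedQR A k) :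
    F.R₁₁ = F.Qᵀ.submatrix (Fin.castLE F.le_rows) id * A.submatrix id F.pivot := by
  have h : A.submatrix id F.pivot = F.Q * F.R.submatrix id (Fin.castLE F.le_cols) :=
    congrArg (Matrix.submatrix · id (Fin.castLE F.le_cols)) F.factor
  have hQ : F.Qᵀ * A.submatrix id F.pivot = F.R.submatrix id (Fin.castLE F.le_cols) := by
    rw [h, ← Matrix.mul_assoc, F.orthogonal, Matrix.one_mul]
  exact congrArg (Matrix.submatrix · (Fin.castLE F.le_rows) id) hQ.symm

theorem le_rank (F : PivotedQR A k) : k ≤ A.rank := by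
  classical
  calc k = F.R₁₁.rank := by
        rw [Matrix.rank_of_isUnit F.R₁₁ ((Matrix.isUnit_iff_isUnit_det _).2 F.leading_isUnit),
          Fintype.card_fin]
    _ ≤ (A.submatrix id F.pivot).rank := by
        rw [R₁₁_eq]
        exact Matrix.rank_mul_le_right _ _
    _ = (A * (1 : Matrix ν ν ℝ).submatrix id F.pivot).rank := by
        congr 1
        ext i j
        simp [Matrix.mul_apply, Matrix.one_apply]
    _ ≤ A.rank := Matrix.rank_mul_le_left _ _

theorem IT_eq (F : PivotedQR A k) :
    F.IT = (1 : Matrix _ _ ℝ).submatrix (Fin.castLE F.le_cols) id +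
      F.T * (1 : Matrix _ _ ℝ).submatrix F.tailIdx id := by
  ext i j
  rcases lt_or_ge (j : ℕ) k with h | h
  · have hne (l) : F.tailIdx l ≠ j := fun hl => by
      have := congrArg Fin.val hl
      simp only [tailIdx] at this
      omega
    simp [IT, Matrix.mul_apply, Matrix.one_apply, h, hne, Fin.ext_iff]
  · have hne : Fin.castLE F.le_cols i ≠ j := fun hi => by
      have := congrArg Fin.val hi
      simp only [Fin.val_castLE] at this
      omega
    have hl (l) : F.tailIdx l = j ↔ l = ⟨(j : ℕ) - k, by have := j.isLt; omega⟩ := by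
      simp only [tailIdx, Fin.ext_iff]
      omega
    simp [IT, Matrix.mul_apply, Matrix.one_apply, h.not_gt, hne, hl]

theorem l2_opNorm_IT_le (F : PivotedQR A k) : ‖F.IT‖ ≤ 1 + frobNorm F.T := by
  have htail : Function.Injective F.tailIdx := fun i j h => by
    simpa [tailIdx, Fin.ext_iff] using h
  rw [IT_eq]
  refine (norm_add_le _ _).trans (add_le_add ?_ ?_)
  · exact l2_opNorm_one_submatrix_le (Fin.castLE_injective F.le_cols)
  · calc _ ≤ ‖F.T‖ * ‖(1 : Matrix _ _ ℝ).submatrix F.tailIdx id‖ := Matrix.l2_opNorm_mul _ _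
      _ ≤ ‖F.T‖ * 1 := by gcongr; exact l2_opNorm_one_submatrix_le htail
      _ ≤ frobNorm F.T := by rw [mul_one]; exact l2_opNorm_le_frobNorm _

theorem exists_norm_sub_le [DecidableEq ν] (F : PivotedQR A k) : ∃ P : Matrix (Fin k) ν ℝ,
    ‖P‖ ≤ 1 + frobNorm F.T ∧ ‖A - A.submatrix id F.pivot * P‖ ≤ ‖F.E‖ := by
  refine ⟨F.IT.submatrix id F.perm.symm,
    (l2_opNorm_id_submatrix_le _ F.perm.symm.injective).trans F.l2_opNorm_IT_le, ?_⟩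
  have h : A - A.submatrix id F.pivot * F.IT.submatrix id F.perm.symm =
      F.E.submatrix id F.perm.symm := by
    ext i j
    simp [E, A₁, Matrix.mul_apply]
  rw [h]
  exact l2_opNorm_id_submatrix_le _ F.perm.symm.injective

theorem exists_norm_transpose_sub_le [DecidableEq ν] (F : PivotedQR Aᵀ k) :
    ∃ L : Matrix μ (Fin k) ℝ, ‖L‖ ≤ 1 + frobNorm F.T ∧
      ‖A - L * A.submatrix F.pivot id‖ ≤ ‖F.E‖ := by
  classical
  obtain ⟨P, hP, hE⟩ := F.exists_norm_sub_le
  refine ⟨Pᵀ, (l2_opNorm_transpose P).trans_le hP, ?_⟩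
  rwa [← l2_opNorm_transpose, Matrix.transpose_sub, Matrix.transpose_mul,
    Matrix.transpose_transpose]

theorem IsStrong.l2_opNorm_E_le [DecidableEq ν] {q₁ q₂ : MvPolynomial (Fin 2) ℝ}
    {F : PivotedQR A k} (hF : F.IsStrong q₁ q₂) :
    ‖F.E‖ ≤ singVal A k * polyVal q₁ (Fintype.card ν) k :=
  (l2_opNorm_le_singVal_zero _).trans (hF.upper 0)

theorem IsStrong.E_eq_zero_of_rank_le [DecidableEq ν] {q₁ q₂ : MvPolynomial (Fin 2) ℝ}
    {F : PivotedQR A k} (hF : F.IsStrong q₁ q₂) (hA : A.rank ≤ k) : F.E = 0 := by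
  have h : singVal A k = 0 :=
    le_antisymm (not_lt.1 ((singVal_pos_iff_lt_rank A k).not.2 hA.not_gt)) (singVal_nonneg A k)
  simpa [h] using hF.l2_opNorm_E_le

end PivotedQR

theorem dotProduct_mulVec_sub_dotProduct_mulVec {R μ ν κ : Type*} [CommRing R]
    [Fintype μ] [Fintype ν] [Fintype κ]
    (A : Matrix μ ν R) (S : Matrix μ κ R) (M : Matrix κ κ R) (W : Matrix κ ν R)
    (s : μ → R) (a : κ → R) (t : ν → R) (b : κ → R) :
    s ⬝ᵥ A *ᵥ t - a ⬝ᵥ M *ᵥ b =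
      s ⬝ᵥ (A - S * M * W) *ᵥ t - (a - s ᵥ* S) ⬝ᵥ (M * W) *ᵥ t -
        s ⬝ᵥ (S * M) *ᵥ (b - W *ᵥ t) - (a - s ᵥ* S) ⬝ᵥ M *ᵥ (b - W *ᵥ t) := by
  simp only [Matrix.sub_mulVec, Matrix.mulVec_sub, sub_dotProduct, dotProduct_sub,
    ← Matrix.mulVec_mulVec, ← Matrix.dotProduct_mulVec]
  ring

section Skeleton

open WithLp (toLp)

variable {μ ν : Type*} [Fintype μ] [Fintype ν] [DecidableEq ν] {k : ℕ}

/-- The rows `I` and columns `J` form a stable skeleton of `A`: up to errors of size `ε` in the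
spectral norm, the columns of `A` are combinations of the columns `J`, whose rows in turn are
combinations of the rows of the core `A(I, J)`, with coefficient matrices of norm at most `β`,
and the inverse of the core amplifies an error of size `ε` to at most `β`. -/
structure IsStableSkeleton (A : Matrix μ ν ℝ) (I : Fin k → μ) (J : Fin k → ν) (ε β : ℝ) :
    Prop where
  isUnit_det_core : IsUnit (A.submatrix I J).det
  mul_norm_inv_core_le : ε * ‖(A.submatrix I J)⁻¹‖ ≤ β
  injective_rows : Function.Injective I
  exists_columns : ∃ P : Matrix (Fin k) ν ℝ, ‖P‖ ≤ β ∧ ‖A - A.submatrix id J * P‖ ≤ ε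
  exists_rows : ∃ L : Matrix μ (Fin k) ℝ, ‖L‖ ≤ β ∧
    ‖A.submatrix id J - L * A.submatrix I J‖ ≤ ε

namespace IsStableSkeleton

variable {A : Matrix μ ν ℝ} {I : Fin k → μ} {J : Fin k → ν} {ε β : ℝ}

theorem l2_opNorm_columns_mul_inv_le (h : IsStableSkeleton A I J ε β) :
    ‖A.submatrix id J * (A.submatrix I J)⁻¹‖ ≤ 2 * β := by
  obtain ⟨L, hL, hE⟩ := h.exists_rows
  set M := (A.submatrix I J)⁻¹
  have heq : A.submatrix id J * M = L + (A.submatrix id J - L * A.submatrix I J) * M := by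
    rw [Matrix.sub_mul, Matrix.mul_assoc L, Matrix.mul_nonsing_inv _ h.isUnit_det_core,
      Matrix.mul_one, add_sub_cancel]
  calc ‖A.submatrix id J * M‖
      ≤ ‖L‖ + ‖A.submatrix id J - L * A.submatrix I J‖ * ‖M‖ := by
        rw [heq]
        exact (norm_add_le _ _).trans (add_le_add_right (Matrix.l2_opNorm_mul _ _) _)
    _ ≤ β + ε * ‖M‖ := by gcongr
    _ ≤ 2 * β := by linarith [h.mul_norm_inv_core_le]

theorem exists_inv_mul_rows_eq (h : IsStableSkeleton A I J ε β) :
    ∃ (P : Matrix (Fin k) ν ℝ) (D : Matrix μ ν ℝ), ‖P‖ ≤ β ∧ ‖D‖ ≤ ε ∧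
      A = A.submatrix id J * P + D ∧
      (A.submatrix I J)⁻¹ * A.submatrix I id = P + (A.submatrix I J)⁻¹ * D.submatrix I id := by
  obtain ⟨P, hP, hD⟩ := h.exists_columns
  refine ⟨P, _, hP, hD, (add_sub_cancel _ _).symm, ?_⟩
  have hrows : A.submatrix I id =
      A.submatrix I J * P + (A - A.submatrix id J * P).submatrix I id := by
    ext i j
    simp [Matrix.mul_apply]
  conv_lhs => rw [hrows, Matrix.mul_add, ← Matrix.mul_assoc,
    Matrix.nonsing_inv_mul _ h.isUnit_det_core, Matrix.one_mul]

theorem l2_opNorm_inv_mul_rows_le (h : IsStableSkeleton A I J ε β) :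
    ‖(A.submatrix I J)⁻¹ * A.submatrix I id‖ ≤ 2 * β := by
  obtain ⟨P, D, hP, hD, -, hrows⟩ := h.exists_inv_mul_rows_eq
  calc ‖(A.submatrix I J)⁻¹ * A.submatrix I id‖
      ≤ ‖P‖ + ‖(A.submatrix I J)⁻¹‖ * ‖D.submatrix I id‖ := by
        rw [hrows]
        exact (norm_add_le _ _).trans (add_le_add_right (Matrix.l2_opNorm_mul _ _) _)
    _ ≤ β + ‖(A.submatrix I J)⁻¹‖ * ε := by
        gcongr
        exact (l2_opNorm_submatrix_id_le D h.injective_rows).trans hD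
    _ ≤ 2 * β := by linarith [h.mul_norm_inv_core_le]

theorem l2_opNorm_sub_cross_le (h : IsStableSkeleton A I J ε β) :
    ‖A - A.submatrix id J * (A.submatrix I J)⁻¹ * A.submatrix I id‖ ≤ ε * (1 + 2 * β) := by
  obtain ⟨P, D, -, hD, hA, hrows⟩ := h.exists_inv_mul_rows_eq
  have heq : A - A.submatrix id J * (A.submatrix I J)⁻¹ * A.submatrix I id =
      D - A.submatrix id J * (A.submatrix I J)⁻¹ * D.submatrix I id := by
    rw [Matrix.mul_assoc, hrows, Matrix.mul_add, ← Matrix.mul_assoc, ← sub_sub]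
    nth_rewrite 1 [hA]
    rw [add_sub_cancel_left]
  calc _ ≤ ‖D‖ + ‖A.submatrix id J * (A.submatrix I J)⁻¹‖ * ‖D.submatrix I id‖ := by
        rw [heq]
        exact (norm_sub_le _ _).trans (add_le_add_right (Matrix.l2_opNorm_mul _ _) _)
    _ ≤ ε + 2 * β * ε := by
        gcongr
        · exact (norm_nonneg _).trans h.l2_opNorm_columns_mul_inv_le
        · exact h.l2_opNorm_columns_mul_inv_le
        · exact (l2_opNorm_submatrix_id_le D h.injective_rows).trans hD
    _ = ε * (1 + 2 * β) := by ring

theorem abs_sub_dotProduct_inv_mulVec_le (h : IsStableSkeleton A I J ε β) {B : ℝ} (hB : 1 ≤ B)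
    (hβ : β ≤ B) {s : μ → ℝ} {t : ν → ℝ} (hs : ‖toLp 2 s‖ ≤ B) (ht : ‖toLp 2 t‖ ≤ B)
    {a b : Fin k → ℝ} (ha : ‖toLp 2 (a - s ᵥ* A.submatrix id J)‖ ≤ ε * B)
    (hb : ‖toLp 2 (b - A.submatrix I id *ᵥ t)‖ ≤ ε * B) {z : ℝ}
    (hz : |z - s ⬝ᵥ A *ᵥ t| ≤ ε) :
    |z - a ⬝ᵥ (A.submatrix I J)⁻¹ *ᵥ b| ≤ 9 * ε * B ^ 3 := by
  have hε : 0 ≤ ε := (abs_nonneg _).trans hz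
  have hsplit := dotProduct_mulVec_sub_dotProduct_mulVec A (A.submatrix id J) (A.submatrix I J)⁻¹
    (A.submatrix I id) s a t b
  set S := A.submatrix id J
  set W := A.submatrix I id
  set M := (A.submatrix I J)⁻¹
  set α := a - s ᵥ* S
  set γ := b - W *ᵥ t
  have h₁ : |s ⬝ᵥ (A - S * M * W) *ᵥ t| ≤ B * (ε * (1 + 2 * B)) * B := by
    refine (abs_dotProduct_mulVec_le s _ t).trans ?_
    gcongr
    exact h.l2_opNorm_sub_cross_le.trans (by gcongr)
  have h₂ : |α ⬝ᵥ (M * W) *ᵥ t| ≤ ε * B * (2 * B) * B := by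
    refine (abs_dotProduct_mulVec_le α _ t).trans ?_
    gcongr
    exact h.l2_opNorm_inv_mul_rows_le.trans (by gcongr)
  have h₃ : |s ⬝ᵥ (S * M) *ᵥ γ| ≤ B * (2 * B) * (ε * B) := by
    refine (abs_dotProduct_mulVec_le s _ γ).trans ?_
    gcongr
    exact h.l2_opNorm_columns_mul_inv_le.trans (by gcongr)
  have h₄ : |α ⬝ᵥ M *ᵥ γ| ≤ ε * B * B * B := by
    calc |α ⬝ᵥ M *ᵥ γ| ≤ ε * B * ‖M‖ * (ε * B) := by
          refine (abs_dotProduct_mulVec_le α _ γ).trans ?_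
          gcongr
      _ = ε * B * (ε * ‖M‖) * B := by ring
      _ ≤ ε * B * B * B := by gcongr; exact h.mul_norm_inv_core_le.trans hβ
  have hB₂ : ε * B ^ 2 ≤ ε * B ^ 3 := by gcongr; norm_num
  have hB₃ : ε ≤ ε * B ^ 3 := le_mul_of_one_le_right hε (one_le_pow₀ hB)
  simp only [abs_le] at hz h₁ h₂ h₃ h₄ ⊢
  constructor <;> linarith

end IsStableSkeleton

end Skeleton

section CUR

variable {μ ν : Type*} [Fintype μ] [Fintype ν] [DecidableEq ν] {k : ℕ}

theorem singVal_mul_l2_opNorm_inv_core_le {A : Matrix μ ν ℝ} {C : Matrix (Fin k) (Fin k) ℝ}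
    {c : ℝ} (hC : IsUnit C.det) (hc : 0 ≤ c) (h : ∀ i < k, singVal A i ≤ c * singVal C i) :
    singVal A k * ‖C⁻¹‖ ≤ c := by
  rcases k.eq_zero_or_pos with rfl | hk
  · simpa [Subsingleton.elim C⁻¹ 0] using hc
  calc singVal A k * ‖C⁻¹‖ ≤ c * singVal C (k - 1) * ‖C⁻¹‖ := by
        gcongr
        exact (singVal_antitone A k.pred_le).trans (h _ (Nat.sub_one_lt hk.ne'))
    _ = c * (singVal C (k - 1) * ‖C⁻¹‖) := mul_assoc _ _ _
    _ ≤ c * 1 := by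
        gcongr
        exact singVal_mul_l2_opNorm_inv_le C hC (by simp only [Fintype.card_fin]; omega)
    _ = c := mul_one c

namespace IsStrongCUR

variable [DecidableEq μ] {q₁ q₂ : MvPolynomial (Fin 2) ℝ} {A : Matrix μ ν ℝ}
  {I : Fin k → μ} {J : Fin k → ν} {ε Q b : ℝ}

theorem le_rank (h : IsStrongCUR q₁ q₂ A I J ε) : k ≤ A.rank := by
  rcases h with ⟨F, -⟩ | ⟨F, -⟩ <;> exact F.le_rank

theorem injective_rows (h : IsStrongCUR q₁ q₂ A I J ε) : Function.Injective I := by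
  rcases h with ⟨-, G, -, -, -, rfl, -⟩ | ⟨-, G, -, -, -, rfl, -⟩ <;> exact G.pivot_injective

theorem le_singVal_mul (h : IsStrongCUR q₁ q₂ A I J ε)
    (hμ : polyVal q₁ (Fintype.card μ) k ≤ Q) (hν : polyVal q₁ (Fintype.card ν) k ≤ Q) :
    ε ≤ singVal A k * Q := by
  have hA := singVal_nonneg A k
  rcases h with ⟨F, -, hF, -, -, -, rfl⟩ | ⟨F, G, hF, hG, -, -, -, rfl⟩
  · exact hF.l2_opNorm_E_le.trans (by gcongr)
  · refine max_le (hF.l2_opNorm_E_le.trans (by gcongr)) (hG.l2_opNorm_E_le.trans ?_)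
    rw [singVal_transpose]
    gcongr

theorem singVal_le_mul_singVal_core (h : IsStrongCUR q₁ q₂ A I J ε) (hQ : 1 ≤ Q)
    (hμ : polyVal q₁ (Fintype.card μ) k ≤ Q) (hν : polyVal q₁ (Fintype.card ν) k ≤ Q)
    {i : ℕ} (hi : i < k) : singVal A i ≤ Q ^ 2 * singVal (A.submatrix I J) i := by
  rcases h with ⟨F, G, hF, hG, rfl, rfl, -⟩ | ⟨-, -, -, -, -, -, hcore, -⟩
  · calc singVal A i ≤ Q * singVal F.A₁ i :=
          (hF.lower i hi).trans (mul_le_mul_of_nonneg_right hν (singVal_nonneg _ i))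
      _ = Q * singVal (A.submatrix id F.pivot)ᵀ i := by rw [singVal_transpose, PivotedQR.A₁]
      _ ≤ Q * (Q * singVal G.A₁ i) := by
          gcongr
          exact (hG.lower i hi).trans (mul_le_mul_of_nonneg_right hμ (singVal_nonneg _ i))
      _ = Q ^ 2 * singVal (A.submatrix G.pivot F.pivot)ᵀ i := by rw [sq, mul_assoc]; rfl
      _ = Q ^ 2 * singVal (A.submatrix G.pivot F.pivot) i := by rw [singVal_transpose]
  · refine (hcore i hi).trans (mul_le_mul_of_nonneg_right ?_ (singVal_nonneg _ i))
    have hmax : polyVal q₁ (max (Fintype.card μ) (Fintype.card ν)) k ≤ Q := by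
      rcases max_choice (Fintype.card μ) (Fintype.card ν) with h | h <;> rwa [h]
    exact hmax.trans (le_self_pow₀ hQ two_ne_zero)

theorem exists_columns (h : IsStrongCUR q₁ q₂ A I J ε)
    (hb : polyVal q₂ (Fintype.card ν) k ≤ b) :
    ∃ P : Matrix (Fin k) ν ℝ, ‖P‖ ≤ 1 + b ∧ ‖A - A.submatrix id J * P‖ ≤ ε := by
  obtain ⟨F, hF, rfl, hε⟩ : ∃ F : PivotedQR A k, F.IsStrong q₁ q₂ ∧ F.pivot = J ∧ ‖F.E‖ ≤ ε := by
    rcases h with ⟨F, -, hF, -, hJ, -, hε⟩ | ⟨F, _, hF, -, hJ, -, -, hε⟩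
    · exact ⟨F, hF, hJ, hε.ge⟩
    · exact ⟨F, hF, hJ, hε ▸ le_max_left _ _⟩
  obtain ⟨P, hP, hE⟩ := F.exists_norm_sub_le
  exact ⟨P, hP.trans (by gcongr; exact hF.interp.trans hb), hE.trans hε⟩

theorem exists_rows (h : IsStrongCUR q₁ q₂ A I J ε) (hb : polyVal q₂ (Fintype.card μ) k ≤ b) :
    ∃ L : Matrix μ (Fin k) ℝ, ‖L‖ ≤ 1 + b ∧
      ‖A.submatrix id J - L * A.submatrix I J‖ ≤ ε := by
  rcases h with ⟨F, G, -, hG, rfl, rfl, rfl⟩ | ⟨F, G, -, hG, rfl, rfl, -, rfl⟩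
  · obtain ⟨L, hL, hE⟩ := G.exists_norm_transpose_sub_le
    have hrank : (A.submatrix id F.pivot)ᵀ.rank ≤ k := by
      simpa using (A.submatrix id F.pivot)ᵀ.rank_le_card_height
    rw [hG.E_eq_zero_of_rank_le hrank, norm_zero] at hE
    exact ⟨L, hL.trans (by gcongr; exact hG.interp.trans hb), hE.trans (norm_nonneg _)⟩
  · obtain ⟨L, hL, hE⟩ := G.exists_norm_transpose_sub_le
    refine ⟨L, hL.trans (by gcongr; exact hG.interp.trans hb), ?_⟩
    calc ‖A.submatrix id F.pivot - L * A.submatrix G.pivot F.pivot‖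
        = ‖(A - L * A.submatrix G.pivot id).submatrix id F.pivot‖ := by
          rw [Matrix.submatrix_sub]
          rfl
      _ ≤ ‖G.E‖ := (l2_opNorm_id_submatrix_le _ F.pivot_injective).trans hE
      _ ≤ max ‖F.E‖ ‖G.E‖ := le_max_right _ _

theorem isStableSkeleton (h : IsStrongCUR q₁ q₂ A I J ε) (hQ : 1 ≤ Q) (hb : 0 ≤ b)
    (hQμ : polyVal q₁ (Fintype.card μ) k ≤ Q) (hQν : polyVal q₁ (Fintype.card ν) k ≤ Q)
    (hbμ : polyVal q₂ (Fintype.card μ) k ≤ b) (hbν : polyVal q₂ (Fintype.card ν) k ≤ b) :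
    IsStableSkeleton A I J ε (Q ^ 3 + b) := by
  have hcore := fun i => h.singVal_le_mul_singVal_core (i := i) hQ hQμ hQν
  have hunit : IsUnit (A.submatrix I J).det := by
    refine isUnit_det_of_singVal_pos _ fun i hi => ?_
    rw [Fintype.card_fin] at hi
    have hA := (singVal_pos_iff_lt_rank A i).2 (hi.trans_le h.le_rank)
    exact pos_of_mul_pos_right (hA.trans_le (hcore i hi)) (by positivity)
  have hβ : 1 + b ≤ Q ^ 3 + b := by gcongr; exact one_le_pow₀ hQ
  obtain ⟨P, hP, hPε⟩ := h.exists_columns hbν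
  obtain ⟨L, hL, hLε⟩ := h.exists_rows hbμ
  refine ⟨hunit, ?_, h.injective_rows, ⟨P, hP.trans hβ, hPε⟩, ⟨L, hL.trans hβ, hLε⟩⟩
  calc ε * ‖(A.submatrix I J)⁻¹‖ ≤ singVal A k * Q * ‖(A.submatrix I J)⁻¹‖ := by
        gcongr
        exact h.le_singVal_mul hQμ hQν
    _ = Q * (singVal A k * ‖(A.submatrix I J)⁻¹‖) := by ring
    _ ≤ Q * Q ^ 2 := by
        gcongr
        exact singVal_mul_l2_opNorm_inv_core_le hunit (by positivity) hcore
    _ = Q ^ 3 := by ring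
    _ ≤ Q ^ 3 + b := le_add_of_nonneg_right hb

end IsStrongCUR

end CUR

section Lagrange

open Polynomial

theorem eq_X_sub_C_mul_lagrangeBasis {F ι : Type*} [Field F] [DecidableEq ι] {s : Finset ι}
    {v : ι → F} (hv : Set.InjOn v s) {p : F[X]} (hdeg : p.degree ≤ s.card)
    (hroot : ∀ i ∈ s, p.eval (v i) = 0) {k : ι} (hk : k ∈ s) :
    p = (X - C (v k)) * (C ((derivative p).eval (v k)) * Lagrange.basis s v k) := by
  obtain ⟨g, rfl⟩ : X - C (v k) ∣ p := dvd_iff_isRoot.2 (hroot k hk)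
  have hdeg_g : g.degree < s.card := by
    rcases eq_or_ne g 0 with rfl | hg
    · simp
    · rw [degree_mul, degree_X_sub_C, degree_eq_natDegree hg] at hdeg
      rw [degree_eq_natDegree hg]
      norm_cast at hdeg ⊢
      omega
  have hroot_g : ∀ i ∈ s, i ≠ k → g.eval (v i) = 0 := fun i hi hik => by
    have h := hroot i hi
    rw [eval_mul, eval_sub, eval_X, eval_C] at h
    exact (mul_eq_zero.1 h).resolve_left (sub_ne_zero.2 fun h => hik (hv hi hk h))
  have hg : g = C (g.eval (v k)) * Lagrange.basis s v k := by
    conv_lhs => rw [Lagrange.eq_interpolate hv hdeg_g, Lagrange.interpolate_apply]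
    refine Finset.sum_eq_single_of_mem k hk fun i hi hik => ?_
    rw [hroot_g i hi hik, C_0, zero_mul]
  have hderiv : (derivative ((X - C (v k)) * g)).eval (v k) = g.eval (v k) := by simp
  rw [hderiv, ← hg]

theorem abs_eval_derivative_mul_abs_eval_lagrangeBasis_le {ι : Type*} [DecidableEq ι]
    {s : Finset ι} {v : ι → ℝ} (hv : Set.InjOn v s) {p : ℝ[X]} (hdeg : p.degree ≤ s.card)
    (hroot : ∀ i ∈ s, p.eval (v i) = 0) {S : Set ℝ} (hS : Convex ℝ S) {M : ℝ}
    (hM : ∀ y ∈ S, |(derivative p).eval y| ≤ M) {k : ι} (hk : k ∈ s) (hvk : v k ∈ S) {x : ℝ}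
    (hx : x ∈ S) :
    |(derivative p).eval (v k)| * |(Lagrange.basis s v k).eval x| ≤ M := by
  rcases eq_or_ne x (v k) with rfl | hne
  · rw [Lagrange.eval_basis_self hv hk, abs_one, mul_one]
    exact hM _ hx
  have hmean : ‖p.eval x - p.eval (v k)‖ ≤ M * ‖x - v k‖ :=
    hS.norm_image_sub_le_of_norm_hasDerivWithin_le (f := fun y => p.eval y)
      (fun y _ => (p.hasDerivAt y).hasDerivWithinAt) hM hvk hx
  have hpx := congrArg (eval x) (eq_X_sub_C_mul_lagrangeBasis hv hdeg hroot hk)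
  rw [hroot k hk, sub_zero, hpx, mul_comm M] at hmean
  simp only [eval_mul, eval_sub, eval_X, eval_C, norm_mul] at hmean
  exact le_of_mul_le_mul_left hmean (norm_pos_iff.2 (sub_ne_zero.2 hne))

end Lagrange

section Chebyshev

open Polynomial

variable {m : ℕ}

theorem chebNode_angle_mem_Ioo (k : Fin m) :
    (2 * (k : ℝ) + 1) / (2 * (m : ℝ)) * Real.pi ∈ Set.Ioo 0 Real.pi := by
  have hm : (0 : ℝ) < m := by exact_mod_cast k.pos
  have hk : (k : ℝ) + 1 ≤ m := by exact_mod_cast k.isLt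
  refine ⟨mul_pos (by positivity) Real.pi_pos, mul_lt_of_lt_one_left Real.pi_pos ?_⟩
  rw [div_lt_one (by positivity)]
  linarith

theorem chebNode_mem_Icc (k : Fin m) : chebNode m k ∈ Set.Icc (-1 : ℝ) 1 :=
  Real.cos_mem_Icc _

theorem chebNode_injective (m : ℕ) : Function.Injective (chebNode m) := by
  intro k l h
  have hm : (m : ℝ) ≠ 0 := by exact_mod_cast k.pos.ne'
  have hangle := Real.injOn_cos (Set.Ioo_subset_Icc_self (chebNode_angle_mem_Ioo k))
    (Set.Ioo_subset_Icc_self (chebNode_angle_mem_Ioo l)) h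
  have hpi := Real.pi_ne_zero
  field_simp at hangle
  exact Fin.ext (by exact_mod_cast (by linarith : (k : ℝ) = l))

theorem cos_mul_chebNode_angle (k : Fin m) :
    Real.cos (m * ((2 * (k : ℝ) + 1) / (2 * (m : ℝ)) * Real.pi)) = 0 := by
  have hm : (m : ℝ) ≠ 0 := by exact_mod_cast k.pos.ne'
  refine Real.cos_eq_zero_iff.2 ⟨k, ?_⟩
  push_cast
  field_simp

theorem eval_T_chebNode (k : Fin m) : (Chebyshev.T ℝ m).eval (chebNode m k) = 0 := by
  rw [chebNode, Chebyshev.T_real_cos]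
  exact_mod_cast cos_mul_chebNode_angle k

theorem abs_eval_derivative_T_le (m : ℕ) {x : ℝ} (hx : x ∈ Set.Icc (-1 : ℝ) 1) :
    |(derivative (Chebyshev.T ℝ m)).eval x| ≤ (m : ℝ) ^ 2 := by
  simpa [Chebyshev.derivative_T_eval_one] using
    Chebyshev.abs_iterate_derivative_T_real_le m 1 (abs_le.2 hx)

theorem abs_eval_derivative_T_chebNode_mul_sin (k : Fin m) :
    |(derivative (Chebyshev.T ℝ m)).eval (chebNode m k)| *
      Real.sin ((2 * (k : ℝ) + 1) / (2 * (m : ℝ)) * Real.pi) = m := by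
  set θ := (2 * (k : ℝ) + 1) / (2 * (m : ℝ)) * Real.pi with hθ
  have hsin : 0 < Real.sin θ := Real.sin_pos_of_mem_Ioo (chebNode_angle_mem_Ioo k)
  have habs : |Real.sin (m * θ)| = 1 := by
    rw [Real.abs_sin_eq_sqrt_one_sub_cos_sq, cos_mul_chebNode_angle]
    simp
  have hU := Chebyshev.U_real_cos θ ((m : ℤ) - 1)
  rw [show (((m : ℤ) - 1 : ℤ) : ℝ) + 1 = m by push_cast; ring] at hU
  rw [chebNode, Chebyshev.T_derivative_eq_U, eval_mul, Int.cast_natCast, eval_natCast, abs_mul,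
    Nat.abs_cast, mul_assoc, ← hθ, ← abs_of_pos hsin, ← abs_mul, hU, habs, mul_one]

theorem abs_eval_lagrangeBasis_chebNode_le (k : Fin m) {x : ℝ} (hx : x ∈ Set.Icc (-1 : ℝ) 1) :
    |(Lagrange.basis Finset.univ (chebNode m) k).eval x| ≤ m := by
  have hm : (0 : ℝ) < m := by exact_mod_cast k.pos
  have hderiv : (m : ℝ) ≤ |(derivative (Chebyshev.T ℝ m)).eval (chebNode m k)| :=
    (abs_eval_derivative_T_chebNode_mul_sin k).symm.trans_le
      (mul_le_of_le_one_right (abs_nonneg _) (Real.sin_le_one _))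
  have hbound := abs_eval_derivative_mul_abs_eval_lagrangeBasis_le (chebNode_injective m).injOn
    (p := Chebyshev.T ℝ m) (by simp [Chebyshev.degree_T]) (fun i _ => eval_T_chebNode i)
    (convex_Icc (-1) 1) (fun y => abs_eval_derivative_T_le m) (Finset.mem_univ k)
    (chebNode_mem_Icc k) hx
  refine le_of_mul_le_mul_left ?_ hm
  calc (m : ℝ) * |(Lagrange.basis Finset.univ (chebNode m) k).eval x|
      ≤ (m : ℝ) ^ 2 := (mul_le_mul_of_nonneg_right hderiv (abs_nonneg _)).trans hbound
    _ = m * m := sq _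

theorem inv_sq_le_chebWeight (k : Fin m) : ((m : ℝ) ^ 2)⁻¹ ≤ chebWeight m k := by
  have hm : (0 : ℝ) < m := by exact_mod_cast k.pos
  rw [chebWeight]
  set θ := (2 * (k : ℝ) + 1) / (2 * (m : ℝ)) * Real.pi
  have hsin : 0 < Real.sin θ := Real.sin_pos_of_mem_Ioo (chebNode_angle_mem_Ioo k)
  have hmsin : (m : ℝ) ≤ m ^ 2 * Real.sin θ :=
    calc (m : ℝ) = _ := (abs_eval_derivative_T_chebNode_mul_sin k).symm
      _ ≤ m ^ 2 * Real.sin θ := by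
        gcongr
        exact abs_eval_derivative_T_le m (chebNode_mem_Icc k)
  have hinv : (m : ℝ)⁻¹ ≤ Real.sin θ := by
    rw [inv_le_iff_one_le_mul₀' hm]
    exact le_of_mul_le_mul_left (by linarith) hm
  calc ((m : ℝ) ^ 2)⁻¹ = 1 / m * (m : ℝ)⁻¹ := by field_simp
    _ ≤ Real.pi / m * Real.sin θ := by
      gcongr
      linarith [Real.pi_gt_three]

theorem chebWeight_le_four (k : Fin m) : chebWeight m k ≤ 4 := by
  have hm : (1 : ℝ) ≤ m := by exact_mod_cast k.pos
  calc chebWeight m k ≤ Real.pi / m * 1 := by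
        rw [chebWeight]
        gcongr
        exact Real.sin_le_one _
    _ ≤ Real.pi := by
        rw [mul_one]
        exact div_le_self Real.pi_pos.le hm
    _ ≤ 4 := Real.pi_le_four

end Chebyshev

section Grid

variable {d : ℕ} {m : Fin d → ℕ}

theorem gridCard_eq_prod (m : Fin d → ℕ) : gridCard m = ∏ i, m i := by
  simp [gridCard, GridIdx]

theorem gridCard_pos (k : GridIdx m) : 0 < gridCard m :=
  Fintype.card_pos_iff.2 ⟨k⟩

theorem gridNode_mem_cube (k : GridIdx m) : gridNode m k ∈ cube d :=
  fun i => chebNode_mem_Icc (k i)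

theorem abs_gridLagrange_le (k : GridIdx m) {x : Fin d → ℝ} (hx : x ∈ cube d) :
    |gridLagrange m k x| ≤ gridCard m := by
  rw [gridLagrange, Finset.abs_prod, gridCard_eq_prod, Nat.cast_prod]
  exact Finset.prod_le_prod (fun _ _ => abs_nonneg _)
    fun i _ => abs_eval_lagrangeBasis_chebNode_le (k i) (hx i)

theorem gridLagrange_gridNode (k l : GridIdx m) :
    gridLagrange m k (gridNode m l) = if k = l then 1 else 0 := by
  split_ifs with h
  · subst h
    exact Finset.prod_eq_one fun i _ =>
      Lagrange.eval_basis_self (chebNode_injective _).injOn (Finset.mem_univ _)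
  · obtain ⟨i, hi⟩ := Function.ne_iff.1 h
    exact Finset.prod_eq_zero (Finset.mem_univ i)
      (Lagrange.eval_basis_of_ne hi (Finset.mem_univ _))

theorem inv_sq_le_gridWeight (k : GridIdx m) : ((gridCard m : ℝ) ^ 2)⁻¹ ≤ gridWeight m k := by
  rw [gridCard_eq_prod, Nat.cast_prod, ← Finset.prod_pow, ← Finset.prod_inv_distrib]
  exact Finset.prod_le_prod (fun i _ => by positivity) fun i _ => inv_sq_le_chebWeight (k i)

theorem gridWeight_pos (k : GridIdx m) : 0 < gridWeight m k := by
  have := gridCard_pos k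
  exact lt_of_lt_of_le (by positivity) (inv_sq_le_gridWeight k)

theorem inv_sqrt_gridWeight_le (k : GridIdx m) : (√(gridWeight m k))⁻¹ ≤ gridCard m := by
  have hcard : (0 : ℝ) < gridCard m := by exact_mod_cast gridCard_pos k
  rw [inv_le_comm₀ (Real.sqrt_pos.2 (gridWeight_pos k)) hcard]
  refine Real.le_sqrt_of_sq_le ?_
  rw [inv_pow]
  exact inv_sq_le_gridWeight k

theorem sqrt_gridWeight_le (k : GridIdx m) : √(gridWeight m k) ≤ 2 ^ d := by
  rw [Real.sqrt_le_left (by positivity)]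
  calc gridWeight m k ≤ ∏ _i : Fin d, (4 : ℝ) :=
        Finset.prod_le_prod (fun i _ => le_trans (by positivity) (inv_sq_le_chebWeight (k i)))
          fun i _ => chebWeight_le_four (k i)
    _ = (2 ^ d) ^ 2 := by
        rw [Finset.prod_const, Finset.card_univ, Fintype.card_fin, ← pow_mul, mul_comm, pow_mul]
        norm_num

/-- The tensor Lagrange basis at `x`, each function divided by the square root of the weight of its
node, so that `K_w` takes the place of `K(X̄, Ȳ)` in the interpolant. -/
noncomputable def scaledLagrange (m : Fin d → ℕ) (x : Fin d → ℝ) (k : GridIdx m) : ℝ :=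
  gridLagrange m k x / √(gridWeight m k)

theorem scaledLagrange_gridNode (l : GridIdx m) :
    scaledLagrange m (gridNode m l) = Pi.single l (√(gridWeight m l))⁻¹ := by
  ext k
  rw [scaledLagrange, gridLagrange_gridNode, Pi.single_apply]
  split_ifs with h
  · rw [h, one_div]
  · rw [zero_div]

theorem norm_scaledLagrange_le {x : Fin d → ℝ} (hx : x ∈ cube d) :
    ‖WithLp.toLp 2 (scaledLagrange m x)‖ ≤ (gridCard m : ℝ) ^ 3 := by
  have habs (k : GridIdx m) : |scaledLagrange m x k| ≤ (gridCard m : ℝ) ^ 2 := by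
    rw [scaledLagrange, abs_div, abs_of_nonneg (Real.sqrt_nonneg _), div_eq_mul_inv, sq]
    gcongr
    · exact abs_gridLagrange_le k hx
    · exact inv_sqrt_gridWeight_le k
  exact (norm_toLp_le_card_mul (by positivity) habs).trans_eq (pow_succ' _ 2).symm

end Grid

section Kernel

variable {d : ℕ} {K : (Fin d → ℝ) → (Fin d → ℝ) → ℝ} {mX mY : Fin d → ℕ} {δ : ℝ}

theorem nodeMatrix_apply (k : GridIdx mX) (l : GridIdx mY) :
    nodeMatrix K mX mY k l =
      √(gridWeight mX k) * K (gridNode mX k) (gridNode mY l) * √(gridWeight mY l) := by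
  simp [nodeMatrix, kernelMatrix]

theorem nodeMatrix_swap : nodeMatrix (Function.swap K) mY mX = (nodeMatrix K mX mY)ᵀ := by
  ext l k
  rw [Matrix.transpose_apply, nodeMatrix_apply, nodeMatrix_apply, Function.swap]
  ring

theorem nodeMatrix_submatrix {k : ℕ} (I : Fin k → GridIdx mX) (J : Fin k → GridIdx mY) :
    (nodeMatrix K mX mY).submatrix I J =
      Matrix.diagonal (fun i => √(gridWeight mX (I i))) *
        kernelMatrix K (gridNode mX ∘ I) (gridNode mY ∘ J) *
        Matrix.diagonal (fun j => √(gridWeight mY (J j))) := by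
  ext i j
  simp [nodeMatrix_apply, kernelMatrix]

theorem sum_gridLagrange_eq_dotProduct (x y : Fin d → ℝ) :
    ∑ k : GridIdx mX, ∑ l : GridIdx mY,
      gridLagrange mX k x * K (gridNode mX k) (gridNode mY l) * gridLagrange mY l y =
    scaledLagrange mX x ⬝ᵥ nodeMatrix K mX mY *ᵥ scaledLagrange mY y := by
  simp only [dotProduct, Matrix.mulVec, Finset.mul_sum, nodeMatrix_apply, scaledLagrange]
  refine Finset.sum_congr rfl fun k _ => Finset.sum_congr rfl fun l _ => ?_
  have hk := (Real.sqrt_pos.2 (gridWeight_pos k)).ne'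
  have hl := (Real.sqrt_pos.2 (gridWeight_pos l)).ne'
  field_simp

namespace InterpolatesWithin

theorem nonneg (h : InterpolatesWithin K mX mY δ) : 0 ≤ δ :=
  (abs_nonneg _).trans (h 0 (by simp [cube]) 0 (by simp [cube]))

theorem swap (h : InterpolatesWithin K mX mY δ) : InterpolatesWithin (Function.swap K) mY mX δ := by
  intro y hy x hx
  rw [Finset.sum_comm]
  simpa only [Function.swap, mul_comm, mul_left_comm] using h x hx y hy

theorem abs_sub_dotProduct_le (h : InterpolatesWithin K mX mY δ) {x y : Fin d → ℝ}
    (hx : x ∈ cube d) (hy : y ∈ cube d) :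
    |K x y - scaledLagrange mX x ⬝ᵥ nodeMatrix K mX mY *ᵥ scaledLagrange mY y| ≤ δ := by
  rw [← sum_gridLagrange_eq_dotProduct]
  exact h x hx y hy

theorem abs_row_sub_le (h : InterpolatesWithin K mX mY δ) {x : Fin d → ℝ} (hx : x ∈ cube d)
    (l : GridIdx mY) :
    |√(gridWeight mY l) * K x (gridNode mY l) -
      (scaledLagrange mX x ᵥ* nodeMatrix K mX mY) l| ≤ 2 ^ d * δ := by
  have hw := Real.sqrt_pos.2 (gridWeight_pos l)
  have hnode := h.abs_sub_dotProduct_le hx (gridNode_mem_cube l)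
  rw [scaledLagrange_gridNode, Matrix.dotProduct_mulVec, dotProduct_single] at hnode
  set r := (scaledLagrange mX x ᵥ* nodeMatrix K mX mY) l
  have hfactor : √(gridWeight mY l) * K x (gridNode mY l) - r =
      √(gridWeight mY l) * (K x (gridNode mY l) - r * (√(gridWeight mY l))⁻¹) := by
    field_simp
  rw [hfactor, abs_mul, abs_of_pos hw]
  gcongr
  exact sqrt_gridWeight_le l

theorem norm_row_sub_le (h : InterpolatesWithin K mX mY δ) {k : ℕ} (J : Fin k → GridIdx mY)
    {x : Fin d → ℝ} (hx : x ∈ cube d) :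
    ‖WithLp.toLp 2 ((fun j => √(gridWeight mY (J j)) * K x (gridNode mY (J j))) -
      scaledLagrange mX x ᵥ* (nodeMatrix K mX mY).submatrix id J)‖ ≤ k * (2 ^ d * δ) := by
  have hδ := h.nonneg
  have hnorm := norm_toLp_le_card_mul (v := _ - _) (by positivity)
    fun j => h.abs_row_sub_le hx (J j)
  rwa [Fintype.card_fin] at hnorm

theorem norm_column_sub_le (h : InterpolatesWithin K mX mY δ) {k : ℕ} (I : Fin k → GridIdx mX)
    {y : Fin d → ℝ} (hy : y ∈ cube d) :
    ‖WithLp.toLp 2 ((fun i => √(gridWeight mX (I i)) * K (gridNode mX (I i)) y) -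
      (nodeMatrix K mX mY).submatrix I id *ᵥ scaledLagrange mY y)‖ ≤ k * (2 ^ d * δ) := by
  have hrow := h.swap.norm_row_sub_le I hy
  rwa [nodeMatrix_swap, ← Matrix.transpose_submatrix, Matrix.vecMul_transpose] at hrow

end InterpolatesWithin

theorem dotProduct_inv_mulVec_diagonal_mul {n F : Type*} [Fintype n] [DecidableEq n] [Field F]
    (M : Matrix n n F) {w v : n → F} (hw : ∀ i, w i ≠ 0) (hv : ∀ i, v i ≠ 0) (a b : n → F) :
    (fun j => v j * a j) ⬝ᵥ (Matrix.diagonal w * M * Matrix.diagonal v)⁻¹ *ᵥ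
      (fun i => w i * b i) = a ⬝ᵥ M⁻¹ *ᵥ b := by
  have isUnit_det {u : n → F} (hu : ∀ i, u i ≠ 0) : IsUnit (Matrix.diagonal u).det := by
    rw [Matrix.det_diagonal]
    exact (Finset.prod_ne_zero_iff.2 fun i _ => hu i).isUnit
  have ha : (fun j => v j * a j) = a ᵥ* Matrix.diagonal v := by
    ext j; rw [Matrix.vecMul_diagonal, mul_comm]
  have hb : (fun i => w i * b i) = Matrix.diagonal w *ᵥ b := by
    ext i; rw [Matrix.mulVec_diagonal]
  rw [ha, hb, ← Matrix.dotProduct_mulVec, Matrix.mulVec_mulVec, Matrix.mulVec_mulVec,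
    Matrix.mul_inv_rev, Matrix.mul_inv_rev, Matrix.mul_assoc, Matrix.mul_assoc,
    Matrix.nonsing_inv_mul_cancel_right _ _ (isUnit_det hw),
    Matrix.mul_nonsing_inv_cancel_left _ _ (isUnit_det hv)]

namespace IsStableSkeleton

variable {k : ℕ} {I : Fin k → GridIdx mX} {J : Fin k → GridIdx mY} {ε β : ℝ}

theorem isUnit_det_kernelMatrix (h : IsStableSkeleton (nodeMatrix K mX mY) I J ε β) :
    IsUnit (kernelMatrix K (gridNode mX ∘ I) (gridNode mY ∘ J)).det := by
  have hcore := h.isUnit_det_core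
  rw [nodeMatrix_submatrix, Matrix.det_mul, Matrix.det_mul] at hcore
  exact isUnit_of_mul_isUnit_right (isUnit_of_mul_isUnit_left hcore)

theorem abs_sub_skelApprox_le (h : IsStableSkeleton (nodeMatrix K mX mY) I J ε β)
    (hK : InterpolatesWithin K mX mY δ) (hδ : δ ≤ ε) {B : ℝ} (hB : 1 ≤ B) (hβ : β ≤ B)
    (hX : (gridCard mX : ℝ) ^ 3 ≤ B) (hY : (gridCard mY : ℝ) ^ 3 ≤ B)
    (hk : (k : ℝ) * 2 ^ d ≤ B) {x y : Fin d → ℝ} (hx : x ∈ cube d) (hy : y ∈ cube d) :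
    |K x y - skelApprox K (gridNode mX ∘ I) (gridNode mY ∘ J) x y| ≤ 9 * ε * B ^ 3 := by
  have hnodes : (k : ℝ) * (2 ^ d * δ) ≤ ε * B :=
    calc (k : ℝ) * (2 ^ d * δ) = k * 2 ^ d * δ := (mul_assoc _ _ _).symm
      _ ≤ B * ε := mul_le_mul hk hδ hK.nonneg (by positivity)
      _ = ε * B := mul_comm _ _
  have hskel := h.abs_sub_dotProduct_inv_mulVec_le hB hβ
    ((norm_scaledLagrange_le hx).trans hX) ((norm_scaledLagrange_le hy).trans hY)
    ((hK.norm_row_sub_le J hx).trans hnodes) ((hK.norm_column_sub_le I hy).trans hnodes)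
    ((hK.abs_sub_dotProduct_le hx hy).trans hδ)
  rwa [nodeMatrix_submatrix, dotProduct_inv_mulVec_diagonal_mul _
    (fun i => (Real.sqrt_pos.2 (gridWeight_pos (I i))).ne')
    (fun j => (Real.sqrt_pos.2 (gridWeight_pos (J j))).ne')] at hskel

end IsStableSkeleton

end Kernel

section PolynomialMajorant

open MvPolynomial

/-- The polynomial obtained by replacing every coefficient with its absolute value; it majorizes
`p` and is monotone on nonnegative arguments. -/
noncomputable def absCoeff {σ : Type*} (p : MvPolynomial σ ℝ) : MvPolynomial σ ℝ :=
  ∑ s ∈ p.support, monomial s |p.coeff s|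

theorem abs_eval_le_eval_absCoeff {σ : Type*} (p : MvPolynomial σ ℝ) {x y : σ → ℝ}
    (hxy : ∀ i, |x i| ≤ y i) : |eval x p| ≤ eval y (absCoeff p) := by
  rw [eval_eq, absCoeff, map_sum]
  refine (Finset.abs_sum_le_sum_abs _ _).trans (Finset.sum_le_sum fun s _ => ?_)
  rw [eval_monomial, abs_mul, Finset.abs_prod, Finsupp.prod]
  gcongr with i
  rw [abs_pow]
  exact pow_le_pow_left₀ (abs_nonneg _) (hxy i) _

theorem abs_polyVal_le_polyVal_absCoeff (q : MvPolynomial (Fin 2) ℝ) {n N : ℕ} (hn : n ≤ N)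
    (k : ℕ) : |polyVal q n k| ≤ polyVal (absCoeff q) N k := by
  refine abs_eval_le_eval_absCoeff q fun i => ?_
  fin_cases i
  · simpa using hn
  · simp

theorem polyVal_absCoeff_nonneg (q : MvPolynomial (Fin 2) ℝ) (n k : ℕ) :
    0 ≤ polyVal (absCoeff q) n k :=
  (abs_nonneg _).trans (abs_polyVal_le_polyVal_absCoeff q le_rfl k)

end PolynomialMajorant

section ErrorBound

open MvPolynomial

/-- A polynomial in `r₀`, `r₁` that bounds every quantity entering the error estimate: the constant
of the stable skeleton, the norms of the scaled Lagrange bases and the number of pivots. -/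
noncomputable def growthPoly (d : ℕ) (q₁ q₂ : MvPolynomial (Fin 2) ℝ) : MvPolynomial (Fin 2) ℝ :=
  (1 + absCoeff q₁) ^ 3 + absCoeff q₂ + X 0 ^ 3 + C (2 ^ d) * X 1

theorem polyVal_growthPoly (d : ℕ) (q₁ q₂ : MvPolynomial (Fin 2) ℝ) (n k : ℕ) :
    polyVal (growthPoly d q₁ q₂) n k =
      (1 + polyVal (absCoeff q₁) n k) ^ 3 + polyVal (absCoeff q₂) n k + n ^ 3 + k * 2 ^ d := by
  simp [polyVal, growthPoly, mul_comm]

theorem one_le_polyVal_growthPoly (d : ℕ) (q₁ q₂ : MvPolynomial (Fin 2) ℝ) (n k : ℕ) :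
    1 ≤ polyVal (growthPoly d q₁ q₂) n k := by
  have hq₁ := one_le_pow₀ (n := 3) (le_add_of_nonneg_right (polyVal_absCoeff_nonneg q₁ n k))
  have hq₂ := polyVal_absCoeff_nonneg q₂ n k
  rw [polyVal_growthPoly, add_assoc, add_assoc]
  exact hq₁.trans (le_add_of_nonneg_right (by positivity))

namespace IsStrongCUR

variable {μ ν : Type*} [Fintype μ] [Fintype ν] [DecidableEq μ] [DecidableEq ν]
  {q₁ q₂ : MvPolynomial (Fin 2) ℝ} {A : Matrix μ ν ℝ} {n k : ℕ} {I : Fin k → μ} {J : Fin k → ν}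
  {ε : ℝ}

theorem isStableSkeleton_absCoeff (h : IsStrongCUR q₁ q₂ A I J ε) (hμ : Fintype.card μ ≤ n)
    (hν : Fintype.card ν ≤ n) :
    IsStableSkeleton A I J ε
      ((1 + polyVal (absCoeff q₁) n k) ^ 3 + polyVal (absCoeff q₂) n k) := by
  have hle (q : MvPolynomial (Fin 2) ℝ) {m : ℕ} (hm : m ≤ n) :
      polyVal q m k ≤ polyVal (absCoeff q) n k :=
    (le_abs_self _).trans (abs_polyVal_le_polyVal_absCoeff q hm k)
  exact h.isStableSkeleton (by linarith [polyVal_absCoeff_nonneg q₁ n k])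
    (polyVal_absCoeff_nonneg q₂ n k) (by linarith [hle q₁ hμ]) (by linarith [hle q₁ hν])
    (hle q₂ hμ) (hle q₂ hν)

theorem le_singVal_mul_growthPoly (h : IsStrongCUR q₁ q₂ A I J ε) (hμ : Fintype.card μ ≤ n)
    (hν : Fintype.card ν ≤ n) (d : ℕ) :
    ε ≤ singVal A k * polyVal (growthPoly d q₁ q₂) n k := by
  have ha := polyVal_absCoeff_nonneg q₁ n k
  have hb := polyVal_absCoeff_nonneg q₂ n k
  have hle {m : ℕ} (hm : m ≤ n) : polyVal q₁ m k ≤ polyVal (growthPoly d q₁ q₂) n k :=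
    calc polyVal q₁ m k ≤ polyVal (absCoeff q₁) n k :=
          (le_abs_self _).trans (abs_polyVal_le_polyVal_absCoeff q₁ hm k)
      _ ≤ 1 + polyVal (absCoeff q₁) n k := le_add_of_nonneg_left zero_le_one
      _ ≤ (1 + polyVal (absCoeff q₁) n k) ^ 3 := le_self_pow₀ (by linarith) three_ne_zero
      _ ≤ polyVal (growthPoly d q₁ q₂) n k := by
        rw [polyVal_growthPoly, add_assoc, add_assoc]
        exact le_add_of_nonneg_right (by positivity)
  exact h.le_singVal_mul (hle hμ) (hle hν)

theorem abs_sub_skelApprox_le {d : ℕ} {K : (Fin d → ℝ) → (Fin d → ℝ) → ℝ} {mX mY : Fin d → ℕ}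
    {δ : ℝ} {I : Fin k → GridIdx mX} {J : Fin k → GridIdx mY}
    (h : IsStrongCUR q₁ q₂ (nodeMatrix K mX mY) I J ε) (hK : InterpolatesWithin K mX mY δ)
    (hδ : δ ≤ ε) (hX : gridCard mX ≤ n) (hY : gridCard mY ≤ n) {x y : Fin d → ℝ}
    (hx : x ∈ cube d) (hy : y ∈ cube d) :
    |K x y - skelApprox K (gridNode mX ∘ I) (gridNode mY ∘ J) x y| ≤
      9 * ε * polyVal (growthPoly d q₁ q₂) n k ^ 3 := by
  have hX' : (gridCard mX : ℝ) ^ 3 ≤ n ^ 3 := by gcongr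
  have hY' : (gridCard mY : ℝ) ^ 3 ≤ n ^ 3 := by gcongr
  have ha : 0 ≤ (1 + polyVal (absCoeff q₁) n k) ^ 3 :=
    pow_nonneg (add_nonneg zero_le_one (polyVal_absCoeff_nonneg q₁ n k)) 3
  have hb := polyVal_absCoeff_nonneg q₂ n k
  have hn : (0 : ℝ) ≤ n ^ 3 := by positivity
  have hk : (0 : ℝ) ≤ k * 2 ^ d := by positivity
  refine (h.isStableSkeleton_absCoeff hX hY).abs_sub_skelApprox_le hK hδ
    (one_le_polyVal_growthPoly d q₁ q₂ n k) ?_ ?_ ?_ ?_ hx hy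
  all_goals
    rw [polyVal_growthPoly]
    linarith

end IsStrongCUR

end ErrorBound

end SkelInterp

open SkelInterp in
theorem theorem2 (d : ℕ) (q₁ q₂ : MvPolynomial (Fin 2) ℝ) :
    ∃ (r r' : MvPolynomial (Fin 2) ℝ) (C : ℝ),
      ∀ (K : (Fin d → ℝ) → (Fin d → ℝ) → ℝ) (mX mY : Fin d → ℕ) (r₀ r₁ : ℕ) (ε δ : ℝ)
        (I : Fin r₁ → GridIdx mX) (J : Fin r₁ → GridIdx mY),
        (∀ i, 0 < mX i) → (∀ i, 0 < mY i) →
        r₀ = max (gridCard mX) (gridCard mY) →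
        InterpolatesWithin K mX mY δ → δ ≤ ε →
        IsStrongCUR q₁ q₂ (nodeMatrix K mX mY) I J ε →
        IsUnit (kernelMatrix K (gridNode mX ∘ I) (gridNode mY ∘ J)).det ∧
        ∀ x ∈ cube d, ∀ y ∈ cube d,
          |K x y - skelApprox K (gridNode mX ∘ I) (gridNode mY ∘ J) x y|
              ≤ C * (ε * polyVal r r₀ r₁) ∧
          |K x y - skelApprox K (gridNode mX ∘ I) (gridNode mY ∘ J) x y|
              ≤ C * (singVal (nodeMatrix K mX mY) r₁ * polyVal r' r₀ r₁) := by
  refine ⟨growthPoly d q₁ q₂ ^ 3, growthPoly d q₁ q₂ ^ 4, 9, ?_⟩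
  intro K mX mY r₀ r₁ ε δ I J _ _ hr₀ hK hδ hCUR
  have hX : gridCard mX ≤ r₀ := hr₀ ▸ le_max_left _ _
  have hY : gridCard mY ≤ r₀ := hr₀ ▸ le_max_right _ _
  refine ⟨(hCUR.isStableSkeleton_absCoeff hX hY).isUnit_det_kernelMatrix, fun x hx y hy => ?_⟩
  have herr := hCUR.abs_sub_skelApprox_le hK hδ hX hY hx hy
  have hε := hCUR.le_singVal_mul_growthPoly hX hY d
  have hG := one_le_polyVal_growthPoly d q₁ q₂ r₀ r₁
  have hpow (N : ℕ) : polyVal (growthPoly d q₁ q₂ ^ N) r₀ r₁ =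
      polyVal (growthPoly d q₁ q₂) r₀ r₁ ^ N := map_pow _ _ _
  rw [hpow, hpow]
  set G := polyVal (growthPoly d q₁ q₂) r₀ r₁
  set σ := singVal (nodeMatrix K mX mY) r₁
  refine ⟨herr.trans_eq (mul_assoc _ _ _), herr.trans ?_⟩
  calc 9 * ε * G ^ 3 ≤ 9 * (σ * G) * G ^ 3 := by gcongr
    _ = 9 * (σ * G ^ 4) := by ring
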